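/- Let $\mathbb{D}$ be the open unit disk and let $dA$ be the area measure on $\mathbb{D}$ divided by $\pi$. For real $\beta$ let $dA_\beta(z)=c_\beta(1-|z|^2)^\beta\,dA(z)$, with $c_\beta=\beta+1$ if $\beta>-1$ (so that $A_\beta(\mathbb{D})=1$) and $c_\beta=1$ if $\beta\le-1$. Let $A^2_\beta$ be the space of analytic functions $f$ on $\mathbb{D}$ with $$\int_{\mathbb{D}}(1-|z|^2)^{2k}|f^{(k)}(z)|^2\,dA_\beta(z)<\infty,$$ where $k$ is a non-negative integer with $2k+\beta>-1$; any such $k$ may be used. Proposition 15. Suppose $\alpha>-1$ and let $\varphi$ be a non-constant finite Blaschke product, that is, $\varphi(z)=c\prod_{i=1}^n\frac{z-a_i}{1-\overline{a_i}z}$ with $n\ge1$, $|c|=1$ and $a_1,\dots,a_n\in\mathbb{D}$. Then $$A^2_{\alpha-1}=\left\{f(z)=\int_{\mathbb{D}}\frac{1-|\varphi(w)|^2}{(1-z\overline w)^{2+\alpha}}\,g(w)\,dA_\alpha(w):\ g\in A^2_{\alpha+1}\right\}$$ $$\phantom{A^2_{\alpha-1}}=\left\{f(z)=\int_{\mathbb{D}}\frac{1-|\varphi(w)|^2}{(1-z\overline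 w)^{2+\alpha}}\,g(w)\,dA_\alpha(w):\ g\in L^2(\mathbb{D},dA_{\alpha+1})\right\},$$ where all these integrals, for $z\in\mathbb{D}$, converge absolutely. -/

import Mathlib

namespace WeightedBergman

noncomputable section

/-- The open unit disk in the complex plane. -/
def disk : Set ℂ := Metric.ball 0 1

/-- The normalizing constant of `areaMeasure α`: for `α > -1` the integral of `(1 - |z|²) ^ α` over
the disk against the normalized area measure is `1 / (α + 1)`, for `α ≤ -1` it is infinite. -/
def normConst (α : ℝ) : ℝ := if -1 < α then α + 1 else 1

/-- The weighted area measure `dA_α = c_α (1 - |z|²) ^ α dA` on the unit disk, where `dA` is the area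
measure divided by `π`; it has total mass one for `α > -1`, and `c_α = 1` for `α ≤ -1`. -/
def areaMeasure (α : ℝ) : MeasureTheory.Measure ℂ :=
  (MeasureTheory.volume.restrict disk).withDensity
    fun z => ENNReal.ofReal (normConst α / Real.pi * (1 - ‖z‖ ^ 2) ^ α)

/-- The generalized weighted Bergman space `A²_α`, described through the derivative of order `k`
(to be used for `2 k + α > -1`): the functions that are analytic on the disk and satisfy
`∫ (1 - |z|²) ^ (2 k) |f⁽ᵏ⁾(z)|² dA_α(z) < ∞`. Only the values of `f` on the disk matter. -/
def bergmanSpace (α : ℝ) (k : ℕ) : Set (ℂ → ℂ) :=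
  {f | DifferentiableOn ℂ f disk ∧
    ∫⁻ z, ENNReal.ofReal ((1 - ‖z‖ ^ 2) ^ (2 * k) * ‖iteratedDeriv k f z‖ ^ 2) ∂(areaMeasure α) < ⊤}

/-- The functions in `L²(𝔻, dA_α)`. -/
def squareIntegrable (α : ℝ) : Set (ℂ → ℂ) :=
  {g | MeasureTheory.MemLp g 2 (areaMeasure α)}

/-- On the disk, `φ` is a finite Blaschke product with `n` factors, that is, of degree `n`. -/
def IsBlaschkeProduct (n : ℕ) (φ : ℂ → ℂ) : Prop :=
  ∃ (c : ℂ) (a : Fin n → ℂ), ‖c‖ = 1 ∧ (∀ i, a i ∈ disk) ∧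
    ∀ z ∈ disk, φ z = c * ∏ i, (z - a i) / (1 - starRingEnd ℂ (a i) * z)

/-- The integrand `(1 - |φ(w)|²) (1 - z w̄) ^ (-(2 + α)) g(w)`. The power is the principal one; for
`z` and `w` in the disk its base has positive real part. -/
def integrand (α : ℝ) (φ g : ℂ → ℂ) (z w : ℂ) : ℂ :=
  ((1 - ‖φ w‖ ^ 2 : ℝ) : ℂ) / (1 - z * starRingEnd ℂ w) ^ ((2 + α : ℝ) : ℂ) * g w

/-- The functions that are given on the disk by
`f(z) = ∫ (1 - |φ(w)|²) (1 - z w̄) ^ (-(2 + α)) g(w) dA_α(w)` for some `g` in `S`. -/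
def integralImage (α : ℝ) (φ : ℂ → ℂ) (S : Set (ℂ → ℂ)) : Set (ℂ → ℂ) :=
  {f | ∃ g ∈ S, ∀ z ∈ disk, f z = ∫ w, integrand α φ g z w ∂(areaMeasure α)}

end

end WeightedBergman

/-! For a non-constant finite Blaschke product, `1 - |φ|²` is comparable to `1 - |w|²`, so the
measure `ν = (1 - |φ|²) dA_α` lies between positive multiples of `A_{α+1}`. Nothing else about `φ`
matters.

In terms of Taylor coefficients, `A²_β` is the condition `∑ (n+1)^(-(β+1)) |a_n|² < ∞`
(`lintegral_iteratedDeriv_lt_top_iff`). Expanding the kernel, `f = ∫ (1 - z w̄)^(-(2+α)) g dν` has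
the coefficients `γ_n ∫ w̄^n g dν`, where `γ_n = multichoose (2+α) n` grows like `n^(α+1)`. The
statement thus becomes a moment problem.

Put `ω_n = (n+1)^((α+2)/2)` and let `J : ℓ² → L²(ν)` send `x` to `∑ x_n ω_n w^n`; its values
represent `A²_{α+1}`. Comparability of `ν` and `A_{α+1}` makes `J` bounded and bounded below. Its
adjoint sends `g` to `(ω_n ∫ w̄^n g dν)`, so the weighted moments of every `L²` function lie in
`ℓ²`; since `J*J` is invertible, every sequence in `ℓ²` arises in this way from some `g = Jx` in
`A²_{α+1}`. Finally `γ_n² / ω_n²` grows like `n^α`, so `ℓ²` moments correspond exactly to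
coefficients of functions in `A²_{α-1}`. -/

namespace WeightedBergman

open MeasureTheory Filter Topology
open scoped ENNReal

/-! ### Sequences comparable to powers of `n + 1` -/

section Coefficients

open scoped Nat

/-- The sequence `u` is bounded above and below by positive multiples of `(n + 1) ^ p`. -/
def PowerGrowth (u : ℕ → ℝ) (p : ℝ) : Prop :=
  ∃ c C : ℝ, 0 < c ∧ 0 < C ∧ ∀ n : ℕ, c * ((n : ℝ) + 1) ^ p ≤ u n ∧ u n ≤ C * ((n : ℝ) + 1) ^ p

namespace PowerGrowth

variable {u v : ℕ → ℝ} {p q : ℝ}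

theorem pos (hu : PowerGrowth u p) (n : ℕ) : 0 < u n := by
  obtain ⟨c, C, hc, hC, h⟩ := hu
  exact lt_of_lt_of_le (by positivity) (h n).1

theorem mul (hu : PowerGrowth u p) (hv : PowerGrowth v q) :
    PowerGrowth (fun n => u n * v n) (p + q) := by
  have hu0 := hu.pos
  have hv0 := hv.pos
  obtain ⟨c, C, hc, hC, h⟩ := hu
  obtain ⟨d, D, hd, hD, h'⟩ := hv
  refine ⟨c * d, C * D, by positivity, by positivity, fun n => ?_⟩
  have hn : (0 : ℝ) < n + 1 := by positivity
  rw [Real.rpow_add hn, mul_mul_mul_comm c d, mul_mul_mul_comm C D]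
  constructor
  · exact mul_le_mul (h n).1 (h' n).1 (by positivity) (hu0 n).le
  · exact mul_le_mul (h n).2 (h' n).2 (hv0 n).le (by positivity)

theorem inv (hu : PowerGrowth u p) : PowerGrowth (fun n => (u n)⁻¹) (-p) := by
  have hu0 := hu.pos
  obtain ⟨c, C, hc, hC, h⟩ := hu
  refine ⟨C⁻¹, c⁻¹, by positivity, by positivity, fun n => ?_⟩
  have hn : (0 : ℝ) < n + 1 := by positivity
  rw [Real.rpow_neg hn.le, ← mul_inv, ← mul_inv]
  constructor
  · exact inv_anti₀ (hu0 n) (h n).2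
  · exact inv_anti₀ (by positivity) (h n).1

theorem const_mul (hu : PowerGrowth u p) {b : ℝ} (hb : 0 < b) :
    PowerGrowth (fun n => b * u n) p := by
  obtain ⟨c, C, hc, hC, h⟩ := hu
  refine ⟨b * c, b * C, by positivity, by positivity, fun n => ?_⟩
  rw [mul_assoc, mul_assoc]
  exact ⟨mul_le_mul_of_nonneg_left (h n).1 hb.le, mul_le_mul_of_nonneg_left (h n).2 hb.le⟩

theorem rpow (p : ℝ) : PowerGrowth (fun n => ((n : ℝ) + 1) ^ p) p :=
  ⟨1, 1, one_pos, one_pos, fun n => by simp⟩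

theorem natCast_add {s : ℝ} (hs : 0 < s) : PowerGrowth (fun n => (n : ℝ) + s) 1 := by
  refine ⟨min 1 s, max 1 s, by positivity, by positivity, fun n => ?_⟩
  have hn : (0 : ℝ) ≤ n := by positivity
  have h1 : min 1 s ≤ 1 := min_le_left _ _
  have h2 : min 1 s ≤ s := min_le_right _ _
  have h3 : 1 ≤ max 1 s := le_max_left _ _
  have h4 : s ≤ max 1 s := le_max_right _ _
  rw [Real.rpow_one]
  constructor <;> nlinarith

theorem sq (hu : PowerGrowth u p) : PowerGrowth (fun n => u n ^ 2) (2 * p) := by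
  simpa only [pow_two, two_mul] using hu.mul hu

/-- Convergent sequences are bounded. Applied to the quotient and, since `L ≠ 0`, to its inverse,
this gives both bounds for all `n`, not only for large `n`. -/
theorem of_tendsto {L : ℝ} (hu : ∀ n, 0 < u n) (hL : 0 < L)
    (h : Tendsto (fun n : ℕ => u n / ((n : ℝ) + 1) ^ p) atTop (𝓝 L)) : PowerGrowth u p := by
  have hn : ∀ n : ℕ, (0 : ℝ) < ((n : ℝ) + 1) ^ p := fun n => by positivity
  obtain ⟨C, hC⟩ := h.bddAbove_range
  obtain ⟨D, hD⟩ := (h.inv₀ hL.ne').bddAbove_range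
  have hC' : ∀ n, u n / ((n : ℝ) + 1) ^ p ≤ C := fun n => hC ⟨n, rfl⟩
  have hD' : ∀ n, (u n / ((n : ℝ) + 1) ^ p)⁻¹ ≤ D := fun n => hD ⟨n, rfl⟩
  have hD0 : 0 < D := lt_of_lt_of_le (inv_pos.2 (div_pos (hu 0) (hn 0))) (hD' 0)
  refine ⟨D⁻¹, C, inv_pos.2 hD0, lt_of_lt_of_le (div_pos (hu 0) (hn 0)) (hC' 0), fun n => ?_⟩
  constructor
  · rw [← le_div_iff₀ (hn n)]
    exact inv_le_of_inv_le₀ (div_pos (hu n) (hn n)) (hD' n)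
  · rw [← div_le_iff₀ (hn n)]
    exact hC' n

theorem summable_iff (hu : PowerGrowth u p) {x : ℕ → ℝ} (hx : ∀ n, 0 ≤ x n) :
    Summable (fun n => u n * x n) ↔ Summable (fun n : ℕ => ((n : ℝ) + 1) ^ p * x n) := by
  have hu0 := hu.pos
  obtain ⟨c, C, hc, hC, h⟩ := hu
  constructor
  · intro hs
    refine Summable.of_nonneg_of_le (fun n => mul_nonneg (by positivity) (hx n)) (fun n => ?_)
      (hs.mul_left c⁻¹)
    rw [← mul_assoc]
    refine mul_le_mul_of_nonneg_right ?_ (hx n)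
    rw [le_inv_mul_iff₀ hc]
    exact (h n).1
  · intro hs
    refine Summable.of_nonneg_of_le (fun n => mul_nonneg (hu0 n).le (hx n)) (fun n => ?_)
      (hs.mul_left C)
    rw [← mul_assoc]
    exact mul_le_mul_of_nonneg_right (h n).2 (hx n)

end PowerGrowth

/-! ### Growth of binomial coefficients, Beta values and factorial quotients -/

theorem factorial_mul_multichoose (s : ℝ) (n : ℕ) :
    (n ! : ℝ) * Ring.multichoose s n = ∏ j ∈ Finset.range n, (s + j) := by
  have := Ring.factorial_nsmul_multichoose_eq_ascPochhammer s n
  rw [nsmul_eq_mul] at this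
  rw [this, Polynomial.ascPochhammer_smeval_eq_eval]
  clear this
  induction n with
  | zero => simp
  | succ n ih => rw [ascPochhammer_succ_eval, Finset.prod_range_succ, ih]

theorem multichoose_pos {s : ℝ} (hs : 0 < s) (n : ℕ) : 0 < Ring.multichoose s n := by
  have h : (0 : ℝ) < n ! * Ring.multichoose s n := by
    rw [factorial_mul_multichoose]
    exact Finset.prod_pos fun j _ => by positivity
  exact pos_of_mul_pos_right h (by positivity)

/-- Euler's limit `n^s n! / (s (s+1) ⋯ (s+n)) → Γ(s)`: the denominator is `n! * multichoose s n * (n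
+ s)`, so `multichoose s n * (n + s)` grows like `n^s`. -/
theorem powerGrowth_multichoose {s : ℝ} (hs : 0 < s) :
    PowerGrowth (fun n => Ring.multichoose s n) (s - 1) := by
  have key : PowerGrowth (fun n => Ring.multichoose s n * (n + s)) s := by
    refine .of_tendsto (L := (Real.Gamma s)⁻¹)
      (fun n => mul_pos (multichoose_pos hs n) (by positivity))
      (inv_pos.2 (Real.Gamma_pos_of_pos hs)) ?_
    have h1 := (Real.GammaSeq_tendsto_Gamma s).inv₀ (Real.Gamma_pos_of_pos hs).ne'
    have h2 : Tendsto (fun n : ℕ => ((n : ℝ) / ((n : ℝ) + 1)) ^ s) atTop (𝓝 1) := by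
      have := (tendsto_natCast_div_add_atTop (1 : ℝ)).rpow_const (p := s) (Or.inl one_ne_zero)
      simpa using this
    have h3 := h1.mul h2
    rw [mul_one] at h3
    refine h3.congr' ?_
    filter_upwards [eventually_gt_atTop 0] with n hn
    have hn' : (0 : ℝ) < n := by exact_mod_cast hn
    have hf : (n ! : ℝ) ≠ 0 := by positivity
    rw [Real.GammaSeq, Finset.prod_range_succ, ← factorial_mul_multichoose,
      Real.div_rpow hn'.le (by positivity)]
    have h4 : (n : ℝ) ^ s ≠ 0 := by positivity
    have h5 : ((n : ℝ) + 1) ^ s ≠ 0 := by positivity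
    field_simp
    ring
  have h := key.mul (PowerGrowth.natCast_add hs).inv
  rw [← sub_eq_add_neg] at h
  convert h using 2 with n
  field_simp

theorem Gamma_natCast_add {s : ℝ} (hs : 0 < s) (n : ℕ) :
    Real.Gamma (n + s) = (∏ j ∈ Finset.range n, (s + j)) * Real.Gamma s := by
  induction n with
  | zero => simp
  | succ n ih =>
    rw [Finset.prod_range_succ, mul_right_comm, ← ih, mul_comm, Nat.cast_succ, add_right_comm,
      Real.Gamma_add_one (by positivity), add_comm s]

/-- The functional equation of `Γ` gives `B(n+1, s) = n! / (s (s+1) ⋯ (s+n))`, the inverse of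
`multichoose s n * (n + s)`. -/
theorem powerGrowth_beta {s : ℝ} (hs : 0 < s) :
    PowerGrowth (fun n => ProbabilityTheory.beta (n + 1) s) (-s) := by
  have h := ((powerGrowth_multichoose hs).mul (PowerGrowth.natCast_add hs)).inv
  rw [sub_add_cancel] at h
  convert h using 2 with n
  have h1 : Real.Gamma ((n : ℝ) + 1 + s) =
      (∏ j ∈ Finset.range (n + 1), (s + j)) * Real.Gamma s := by
    exact_mod_cast Gamma_natCast_add hs (n + 1)
  have h2 := multichoose_pos hs n
  have h3 := Real.Gamma_pos_of_pos hs
  have h4 : (n ! : ℝ) ≠ 0 := by positivity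
  rw [ProbabilityTheory.beta, Real.Gamma_nat_eq_factorial, h1, Finset.prod_range_succ,
    ← factorial_mul_multichoose]
  field_simp
  ring

theorem powerGrowth_factorial_div (k : ℕ) :
    PowerGrowth (fun n => ((n + k)! : ℝ) / n !) k := by
  induction k with
  | zero =>
    refine ⟨1, 1, one_pos, one_pos, fun n => ?_⟩
    have h4 : (n ! : ℝ) ≠ 0 := by positivity
    simp [h4]
  | succ k ih =>
    have h := ih.mul (PowerGrowth.natCast_add (s := k + 1) (by positivity))
    convert h using 2 with n
    · rw [← add_assoc, Nat.factorial_succ]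
      push_cast
      ring
    · push_cast; rfl

/-! ### Parseval's identity -/

/-- Pairing the series with `e j` identifies `c j`; pairing it with `x` then gives the norm. The
system need not be complete, which allows the use of the non-negative frequencies alone. -/
theorem hasSum_sq_norm_of_orthonormal {ι E : Type*} [NormedAddCommGroup E] [InnerProductSpace ℂ E]
    {e : ι → E} (he : Orthonormal ℂ e) {c : ι → ℂ} {x : E} (h : HasSum (fun i => c i • e i) x) :
    HasSum (fun i => ‖c i‖ ^ 2) (‖x‖ ^ 2) := by
  classical
  have h1 : ∀ j, inner ℂ (e j) x = c j := fun j => by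
    have h2 := h.mapL (innerSL ℂ (e j))
    have h3 : (fun i => innerSL ℂ (e j) (c i • e i)) = fun i => if i = j then c j else 0 := by
      funext i
      rw [innerSL_apply_apply, inner_smul_right, orthonormal_iff_ite.1 he j i]
      by_cases hij : i = j
      · subst hij; simp
      · simp [hij, Ne.symm hij]
    rw [h3] at h2
    exact h2.unique (hasSum_ite_eq j (c j))
  have h4 := h.mapL (innerSL ℂ x)
  have h5 := Complex.hasSum_re h4
  convert h5 using 1
  · funext i
    rw [innerSL_apply_apply, inner_smul_right, ← inner_conj_symm, h1, Complex.mul_conj,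
      Complex.ofReal_re, Complex.normSq_eq_norm_sq]
  · rw [innerSL_apply_apply]
    exact (inner_self_eq_norm_sq (𝕜 := ℂ) x).symm

theorem ofReal_sq_norm_eq_lintegral {X : Type*} [MeasurableSpace X] {μ : Measure X}
    (x : Lp ℂ 2 μ) : ENNReal.ofReal (‖x‖ ^ 2) = ∫⁻ t, ENNReal.ofReal (‖x t‖ ^ 2) ∂μ := by
  have h := eLpNorm_nnreal_pow_eq_lintegral (f := x) (μ := μ) (p := 2) two_ne_zero
  rw [Lp.norm_def, ENNReal.ofReal_pow ENNReal.toReal_nonneg,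
    ENNReal.ofReal_toReal (Lp.eLpNorm_ne_top x)]
  simp only [ENNReal.ofReal_pow (norm_nonneg _), ofReal_norm]
  simpa using h

/-- Parseval's identity for an absolutely convergent one-sided trigonometric series. -/
theorem lintegral_sq_norm_of_hasSum {c : ℕ → ℂ} (hc : Summable fun n => ‖c n‖) {u : ℝ → ℂ}
    (hu : ∀ θ : ℝ, HasSum (fun n : ℕ => c n * Complex.exp (θ * Complex.I) ^ n) (u θ)) :
    ∫⁻ θ in Set.Ioo (-Real.pi) Real.pi, ENNReal.ofReal (‖u θ‖ ^ 2) =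
      ENNReal.ofReal (2 * Real.pi) * ∑' n, ENNReal.ofReal (‖c n‖ ^ 2) := by
  have : Fact (0 < 2 * Real.pi) := ⟨Real.two_pi_pos⟩
  have hs : Summable fun n : ℕ => c n • (fourier (n : ℤ) : C(AddCircle (2 * Real.pi), ℂ)) := by
    refine Summable.of_norm ?_
    simpa [norm_smul, fourier_norm] using hc
  obtain ⟨F, hF⟩ := hs
  have hFu : ∀ θ : ℝ, F (θ : AddCircle (2 * Real.pi)) = u θ := fun θ => by
    have h1 := hF.mapL (ContinuousMap.evalCLM ℂ (θ : AddCircle (2 * Real.pi)))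
    refine h1.unique ?_
    convert hu θ using 2 with n
    simp only [ContinuousMap.evalCLM_apply, ContinuousMap.smul_apply, smul_eq_mul]
    rw [fourier_coe_apply, ← Complex.exp_nat_mul]
    congr 2
    have : (Real.pi : ℂ) ≠ 0 := by exact_mod_cast Real.pi_ne_zero
    push_cast
    field_simp
  -- The series converges uniformly on the circle, hence also in `L²`.
  have h2 := hF.mapL (ContinuousMap.toLp (E := ℂ) 2 AddCircle.haarAddCircle ℂ)
  have ho : Orthonormal ℂ (fun n : ℕ => @fourierLp (2 * Real.pi) _ 2 _ (n : ℤ)) :=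
    orthonormal_fourier.comp _ Nat.cast_injective
  have h3 := hasSum_sq_norm_of_orthonormal ho (c := c)
    (x := ContinuousMap.toLp (E := ℂ) 2 AddCircle.haarAddCircle ℂ F) (by simpa using h2)
  rw [← ENNReal.ofReal_tsum_of_nonneg (fun n => by positivity) h3.summable, h3.tsum_eq,
    ofReal_sq_norm_eq_lintegral]
  have h4 : ∫⁻ t, ENNReal.ofReal (‖ContinuousMap.toLp (E := ℂ) 2 AddCircle.haarAddCircle ℂ F t‖ ^ 2)
      ∂(@AddCircle.haarAddCircle (2 * Real.pi) _) =
      ∫⁻ t, ENNReal.ofReal (‖F t‖ ^ 2) ∂(@AddCircle.haarAddCircle (2 * Real.pi) _) := by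
    refine lintegral_congr_ae ?_
    filter_upwards [ContinuousMap.coeFn_toLp (𝕜 := ℂ) (p := 2)
      (@AddCircle.haarAddCircle (2 * Real.pi) _) F] with t ht
    rw [ht]
  rw [h4, ← smul_eq_mul, ← lintegral_smul_measure, ← AddCircle.volume_eq_smul_haarAddCircle,
    ← AddCircle.lintegral_preimage (2 * Real.pi) (-Real.pi),
    show -Real.pi + 2 * Real.pi = Real.pi by ring, restrict_Ioo_eq_restrict_Ioc]
  simp_rw [hFu]

/-! ### Power series on the disk -/

theorem mem_disk {z : ℂ} : z ∈ disk ↔ ‖z‖ < 1 := by simp [disk]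

theorem isOpen_disk : IsOpen disk := Metric.isOpen_ball

theorem measurableSet_disk : MeasurableSet disk := isOpen_disk.measurableSet

theorem one_sub_sq_norm_pos {z : ℂ} (hz : z ∈ disk) : 0 < 1 - ‖z‖ ^ 2 := by
  have := mem_disk.1 hz
  nlinarith [norm_nonneg z]

section PowerSeries

variable {b : ℕ → ℂ} {h : ℂ → ℂ}

theorem hasFPowerSeriesOnBall_of_hasSum (hb : ∀ z ∈ disk, HasSum (fun n => b n * z ^ n) (h z)) :
    HasFPowerSeriesOnBall h (FormalMultilinearSeries.ofScalars ℂ b) 0 1 where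
  r_le := by
    refine le_of_forall_lt fun r hr => ?_
    obtain ⟨r', hr, hr'⟩ := ENNReal.lt_iff_exists_nnreal_btwn.1 hr
    refine lt_of_lt_of_le hr (FormalMultilinearSeries.le_radius_of_summable _ ?_)
    have h1 : ((r' : ℝ) : ℂ) ∈ disk := by
      rw [mem_disk]
      simpa using hr'
    simpa [FormalMultilinearSeries.ofScalars_norm] using (hb _ h1).summable.norm
  r_pos := one_pos
  hasSum := by
    intro z hz
    have hz' : z ∈ disk := by
      rw [← ENNReal.ofReal_one, Metric.eball_ofReal] at hz
      exact hz
    simpa [mul_comm] using hb z hz'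

theorem differentiableOn_of_hasSum (hb : ∀ z ∈ disk, HasSum (fun n => b n * z ^ n) (h z)) :
    DifferentiableOn ℂ h disk := by
  have := (hasFPowerSeriesOnBall_of_hasSum hb).differentiableOn
  rwa [← ENNReal.ofReal_one, Metric.eball_ofReal] at this

theorem iteratedDeriv_of_hasSum (hb : ∀ z ∈ disk, HasSum (fun n => b n * z ^ n) (h z)) (n : ℕ) :
    iteratedDeriv n h 0 = n ! * b n := by
  have h1 := (hasFPowerSeriesOnBall_of_hasSum hb).factorial_smul 1 n
  rw [iteratedDeriv_eq_iteratedFDeriv, ← h1]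
  change n ! • (FormalMultilinearSeries.ofScalars ℂ b n fun _ => 1) = _
  rw [FormalMultilinearSeries.ofScalars_apply_eq, nsmul_eq_mul, one_pow, smul_eq_mul, mul_one]

theorem hasSum_of_differentiableOn (hh : DifferentiableOn ℂ h disk) {z : ℂ} (hz : z ∈ disk) :
    HasSum (fun n => (n ! : ℂ)⁻¹ * iteratedDeriv n h 0 * z ^ n) (h z) := by
  have := Complex.hasSum_taylorSeries_on_ball hh hz
  simpa only [sub_zero, smul_eq_mul, mul_assoc, mul_comm (z ^ _)] using this

theorem differentiableOn_iteratedDeriv (hh : DifferentiableOn ℂ h disk) (k : ℕ) :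
    DifferentiableOn ℂ (iteratedDeriv k h) disk := by
  induction k with
  | zero => simpa using hh
  | succ k ih =>
    rw [iteratedDeriv_succ]
    exact ih.deriv isOpen_disk

theorem hasSum_iteratedDeriv (hb : ∀ z ∈ disk, HasSum (fun n => b n * z ^ n) (h z)) (k : ℕ)
    {z : ℂ} (hz : z ∈ disk) :
    HasSum (fun n => (((n + k)! / n ! : ℝ) : ℂ) * b (n + k) * z ^ n) (iteratedDeriv k h z) := by
  have h1 := hasSum_of_differentiableOn
    (differentiableOn_iteratedDeriv (differentiableOn_of_hasSum hb) k) hz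
  convert h1 using 2 with n
  have h2 : iteratedDeriv n (iteratedDeriv k h) 0 = (n + k)! * b (n + k) := by
    rw [← iteratedDeriv_of_hasSum hb, iteratedDeriv_eq_iterate, iteratedDeriv_eq_iterate,
      iteratedDeriv_eq_iterate, Function.iterate_add_apply]
  rw [h2]
  push_cast
  ring

end PowerSeries

/-! ### Weighted area integrals in terms of Taylor coefficients -/

theorem lintegral_disk_eq {f : ℂ → ℝ≥0∞} (hf : Measurable (disk.indicator f)) :
    ∫⁻ z in disk, f z = ∫⁻ r in Set.Ioo (0 : ℝ) 1, ENNReal.ofReal r *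
      ∫⁻ θ in Set.Ioo (-Real.pi) Real.pi, f (r * Complex.exp (θ * Complex.I)) := by
  rw [← lintegral_indicator measurableSet_disk, ← Complex.lintegral_comp_polarCoord_symm,
    polarCoord_target, Measure.volume_eq_prod, ← Measure.prod_restrict, lintegral_prod]
  · have hsub : Set.Ioo (0 : ℝ) 1 = Set.Iio 1 ∩ Set.Ioi 0 := by
      ext r; simp [and_comm]
    rw [hsub, ← Measure.restrict_restrict measurableSet_Iio,
      ← lintegral_indicator measurableSet_Iio]
    refine setLIntegral_congr_fun measurableSet_Ioi fun r hr => ?_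
    have hr' : (0 : ℝ) < r := hr
    have hp : ∀ θ : ℝ, Complex.polarCoord.symm (r, θ) = r * Complex.exp (θ * Complex.I) :=
      fun θ => by rw [Complex.polarCoord_symm_apply, Complex.exp_mul_I]; simp
    have hmem : ∀ θ : ℝ, (r * Complex.exp (θ * Complex.I) : ℂ) ∈ disk ↔ r ∈ Set.Iio (1 : ℝ) :=
      fun θ => by simp [mem_disk, Complex.norm_exp_ofReal_mul_I, abs_of_pos hr']
    simp only [hp, smul_eq_mul]
    by_cases h1 : r ∈ Set.Iio (1 : ℝ)
    · rw [Set.indicator_of_mem h1, lintegral_const_mul' _ _ ENNReal.ofReal_ne_top]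
      simp only [Set.indicator_of_mem ((hmem _).2 h1)]
    · rw [Set.indicator_of_notMem h1]
      simp only [Set.indicator_of_notMem (fun h => h1 ((hmem _).1 h)), mul_zero, lintegral_zero]
  · refine Measurable.aemeasurable ?_
    have h2 : Measurable fun p : ℝ × ℝ => Complex.polarCoord.symm p := by
      simp only [Complex.polarCoord_symm_apply]
      fun_prop
    simp only [smul_eq_mul]
    exact (ENNReal.measurable_ofReal.comp measurable_fst).mul (hf.comp h2)

/-- The substitution `t = r²`, with Jacobian `2r`, turns the total mass of the Beta distribution
into this integral. -/
theorem lintegral_pow_mul_one_sub_sq_rpow {s : ℝ} (hs : -1 < s) (n : ℕ) :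
    ∫⁻ r in Set.Ioo (0 : ℝ) 1, ENNReal.ofReal (2 * r * ((r ^ 2) ^ n * (1 - r ^ 2) ^ s)) =
      ENNReal.ofReal (ProbabilityTheory.beta (n + 1) (s + 1)) := by
  have hn : (0 : ℝ) < n + 1 := by positivity
  have hs' : 0 < s + 1 := by linarith
  have hb := ProbabilityTheory.beta_pos hn hs'
  have h1 := ProbabilityTheory.lintegral_betaPDF_eq_one hn hs'
  rw [ProbabilityTheory.lintegral_betaPDF] at h1
  have himg : (fun r : ℝ => r ^ 2) '' Set.Ioo 0 1 = Set.Ioo 0 1 := by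
    ext t
    constructor
    · rintro ⟨r, ⟨h0, h1⟩, rfl⟩
      exact ⟨by positivity, by nlinarith⟩
    · rintro ⟨h0, h1⟩
      exact ⟨√t, ⟨Real.sqrt_pos.2 h0, (Real.sqrt_lt' one_pos).2 (by simpa using h1)⟩,
        Real.sq_sqrt h0.le⟩
  have hd : ∀ r ∈ Set.Ioo (0 : ℝ) 1, HasDerivWithinAt (fun r : ℝ => r ^ 2) (2 * r)
      (Set.Ioo 0 1) r := fun r _ => by
    simpa using (hasDerivAt_pow 2 r).hasDerivWithinAt
  have hinj : Set.InjOn (fun r : ℝ => r ^ 2) (Set.Ioo 0 1) := fun x hx y hy hxy => by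
    exact (pow_left_inj₀ hx.1.le hy.1.le two_ne_zero).1 hxy
  rw [← himg, lintegral_image_eq_lintegral_abs_deriv_mul measurableSet_Ioo hd hinj] at h1
  have h2 := congrArg (fun x => ENNReal.ofReal (ProbabilityTheory.beta (n + 1) (s + 1)) * x) h1
  simp only [mul_one] at h2
  rw [← h2, ← lintegral_const_mul' _ _ ENNReal.ofReal_ne_top]
  refine setLIntegral_congr_fun measurableSet_Ioo fun r hr => ?_
  have hr0 := hr.1
  have hr1 := hr.2
  have h3 : 0 < 1 - r ^ 2 := by nlinarith
  rw [abs_of_pos (by positivity), ← ENNReal.ofReal_mul (by positivity),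
    ← ENNReal.ofReal_mul hb.le, add_sub_cancel_right, add_sub_cancel_right, Real.rpow_natCast]
  congr 1
  field_simp

/-- The norm identity for power series on the disk with a radial weight. -/
theorem lintegral_disk_sq_norm {b : ℕ → ℂ} {h : ℂ → ℂ}
    (hb : ∀ z ∈ disk, HasSum (fun n => b n * z ^ n) (h z)) {s : ℝ} (hs : -1 < s) :
    ∫⁻ z in disk, ENNReal.ofReal ((1 - ‖z‖ ^ 2) ^ s * ‖h z‖ ^ 2) =
      ∑' n : ℕ, ENNReal.ofReal (Real.pi * ProbabilityTheory.beta (n + 1) (s + 1) * ‖b n‖ ^ 2) := by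
  have hc : ContinuousOn h disk := (differentiableOn_of_hasSum hb).continuousOn
  rw [lintegral_disk_eq]
  swap
  · classical
    have hf : ContinuousOn (fun z : ℂ => ENNReal.ofReal ((1 - ‖z‖ ^ 2) ^ s * ‖h z‖ ^ 2)) disk := by
      refine ENNReal.continuous_ofReal.comp_continuousOn (ContinuousOn.mul ?_ (hc.norm.pow 2))
      exact ContinuousOn.rpow_const (by fun_prop) fun z hz => Or.inl (one_sub_sq_norm_pos hz).ne'
    have := hf.measurable_piecewise (g := fun _ => 0) continuousOn_const measurableSet_disk
    rwa [show (fun _ : ℂ => (0 : ℝ≥0∞)) = 0 from rfl, Set.piecewise_eq_indicator] at this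
  -- On each circle Parseval removes the cross terms; the sum over `n` is then exchanged with the
  -- radial integral by Tonelli.
  have h1 : ∀ r ∈ Set.Ioo (0 : ℝ) 1, ENNReal.ofReal r *
      ∫⁻ θ in Set.Ioo (-Real.pi) Real.pi,
        ENNReal.ofReal ((1 - ‖(r * Complex.exp (θ * Complex.I) : ℂ)‖ ^ 2) ^ s *
          ‖h (r * Complex.exp (θ * Complex.I))‖ ^ 2) =
      ∑' n, ENNReal.ofReal (Real.pi * ‖b n‖ ^ 2) *
        ENNReal.ofReal (2 * r * ((r ^ 2) ^ n * (1 - r ^ 2) ^ s)) := by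
    intro r hr
    have hr0 := hr.1
    have hr1 := hr.2
    have h3 : 0 < 1 - r ^ 2 := by nlinarith
    have hn : ∀ θ : ℝ, ‖(r * Complex.exp (θ * Complex.I) : ℂ)‖ = r := fun θ => by
      simp [Complex.norm_exp_ofReal_mul_I, abs_of_pos hr0]
    have hsum : Summable fun n => ‖b n * (r : ℂ) ^ n‖ :=
      (hb r (by rw [mem_disk]; simpa [abs_of_pos hr0] using hr1)).summable.norm
    have h4 := lintegral_sq_norm_of_hasSum hsum (u := fun θ => h (r * Complex.exp (θ * Complex.I)))
      (fun θ => by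
        have := hb (r * Complex.exp (θ * Complex.I)) (by rw [mem_disk, hn]; exact hr1)
        convert this using 2 with n
        ring)
    simp only [hn, ENNReal.ofReal_mul (Real.rpow_nonneg h3.le s)]
    rw [lintegral_const_mul' _ _ ENNReal.ofReal_ne_top, h4, ← mul_assoc, ← mul_assoc,
      ← ENNReal.tsum_mul_left]
    refine tsum_congr fun n => ?_
    rw [← ENNReal.ofReal_mul (by positivity), ← ENNReal.ofReal_mul (by positivity),
      ← ENNReal.ofReal_mul (by positivity), ← ENNReal.ofReal_mul (by positivity)]
    congr 1
    simp only [norm_mul, norm_pow, Complex.norm_real, Real.norm_eq_abs, abs_of_pos hr0]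
    ring
  rw [setLIntegral_congr_fun measurableSet_Ioo h1, lintegral_tsum]
  · refine tsum_congr fun n => ?_
    rw [lintegral_const_mul' _ _ ENNReal.ofReal_ne_top, lintegral_pow_mul_one_sub_sq_rpow hs,
      ← ENNReal.ofReal_mul (by positivity)]
    congr 1
    ring
  · intro n
    refine Measurable.aemeasurable ?_
    fun_prop

/-- Needed to absorb the index shift `n + k` caused by `k` differentiations. Negative exponents
follow by inversion, because `x ↦ x^p` reverses order there. -/
theorem powerGrowth_natCast_add_rpow {s : ℝ} (hs : 0 < s) (p : ℝ) :
    PowerGrowth (fun n => ((n : ℝ) + s) ^ p) p := by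
  have key : ∀ q : ℝ, 0 ≤ q → PowerGrowth (fun n => ((n : ℝ) + s) ^ q) q := by
    intro q hq
    obtain ⟨c, C, hc, hC, h⟩ := PowerGrowth.natCast_add hs
    refine ⟨c ^ q, C ^ q, by positivity, by positivity, fun n => ?_⟩
    have hn := h n
    rw [Real.rpow_one] at hn
    rw [← Real.mul_rpow hc.le (by positivity), ← Real.mul_rpow hC.le (by positivity)]
    exact ⟨Real.rpow_le_rpow (by positivity) hn.1 hq, Real.rpow_le_rpow (by positivity) hn.2 hq⟩
  rcases le_total 0 p with hp | hp
  · exact key p hp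
  · have h := (key (-p) (neg_nonneg.2 hp)).inv
    rw [neg_neg] at h
    convert h using 2 with n
    rw [Real.rpow_neg (by positivity), inv_inv]

/-! ### Coefficient description of the Bergman spaces -/

theorem normConst_pos (β : ℝ) : 0 < normConst β := by
  unfold normConst
  split_ifs with h
  · linarith
  · exact one_pos

theorem measurable_density (β : ℝ) : Measurable fun z : ℂ =>
    ENNReal.ofReal (normConst β / Real.pi * (1 - ‖z‖ ^ 2) ^ β) := by
  fun_prop

theorem lintegral_areaMeasure (β : ℝ) (F : ℂ → ℝ≥0∞) :
    ∫⁻ z, F z ∂(areaMeasure β) =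
      ∫⁻ z in disk, ENNReal.ofReal (normConst β / Real.pi * (1 - ‖z‖ ^ 2) ^ β) * F z := by
  rw [areaMeasure, lintegral_withDensity_eq_lintegral_mul_non_measurable _ (measurable_density β)
    (Eventually.of_forall fun z => ENNReal.ofReal_lt_top)]
  rfl

theorem lintegral_areaMeasure_sq_norm {b : ℕ → ℂ} {h : ℂ → ℂ}
    (hb : ∀ z ∈ disk, HasSum (fun n => b n * z ^ n) (h z)) {β : ℝ} {k : ℕ}
    (hk : -1 < 2 * (k : ℝ) + β) :
    ∫⁻ z, ENNReal.ofReal ((1 - ‖z‖ ^ 2) ^ (2 * k) * ‖h z‖ ^ 2) ∂(areaMeasure β) =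
      ∑' n : ℕ, ENNReal.ofReal
        (normConst β * ProbabilityTheory.beta (n + 1) (2 * k + β + 1) * ‖b n‖ ^ 2) := by
  have hc := normConst_pos β
  have h1 : ∫⁻ z, ENNReal.ofReal ((1 - ‖z‖ ^ 2) ^ (2 * k) * ‖h z‖ ^ 2) ∂(areaMeasure β) =
      ∫⁻ z in disk, ENNReal.ofReal (normConst β / Real.pi) *
        ENNReal.ofReal ((1 - ‖z‖ ^ 2) ^ (2 * k + β) * ‖h z‖ ^ 2) := by
    rw [lintegral_areaMeasure]
    refine setLIntegral_congr_fun measurableSet_disk fun z hz => ?_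
    have hz' := one_sub_sq_norm_pos hz
    rw [← ENNReal.ofReal_mul (by positivity), ← ENNReal.ofReal_mul (by positivity)]
    congr 1
    rw [Real.rpow_add hz', show 2 * (k : ℝ) = ((2 * k : ℕ) : ℝ) by push_cast; rfl,
      Real.rpow_natCast]
    ring
  rw [h1, lintegral_const_mul' _ _ ENNReal.ofReal_ne_top, lintegral_disk_sq_norm hb hk,
    ← ENNReal.tsum_mul_left]
  refine tsum_congr fun n => ?_
  rw [← ENNReal.ofReal_mul (by positivity)]
  congr 1
  field_simp

theorem tsum_ofReal_lt_top_iff {x : ℕ → ℝ} (hx : ∀ n, 0 ≤ x n) :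
    ∑' n, ENNReal.ofReal (x n) < ⊤ ↔ Summable x := by
  constructor
  · intro h
    have := ENNReal.summable_toReal h.ne
    simpa only [ENNReal.toReal_ofReal (hx _)] using this
  · intro h
    rw [← ENNReal.ofReal_tsum_of_nonneg hx h]
    exact ENNReal.ofReal_lt_top

/-- Differentiating `k` times multiplies squared coefficients by a factor of order `n^(2k)`, while
the Beta weight has order `n^(-(2k+β+1))`. The product has order `n^(-(β+1))`, so the choice of `k`
is immaterial. -/
theorem lintegral_iteratedDeriv_lt_top_iff {a : ℕ → ℂ} {f : ℂ → ℂ}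
    (ha : ∀ z ∈ disk, HasSum (fun n => a n * z ^ n) (f z)) {β : ℝ} {k : ℕ}
    (hk : -1 < 2 * (k : ℝ) + β) :
    ∫⁻ z, ENNReal.ofReal ((1 - ‖z‖ ^ 2) ^ (2 * k) * ‖iteratedDeriv k f z‖ ^ 2) ∂(areaMeasure β) < ⊤
      ↔ Summable fun n : ℕ => ((n : ℝ) + 1) ^ (-(β + 1)) * ‖a n‖ ^ 2 := by
  have hs : 0 < 2 * (k : ℝ) + β + 1 := by linarith
  have hu : PowerGrowth (fun n => normConst β * (ProbabilityTheory.beta (n + 1) (2 * k + β + 1) *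
      (((n + k)! : ℝ) / n !) ^ 2)) (-(β + 1)) := by
    have := ((powerGrowth_beta hs).mul (powerGrowth_factorial_div k).sq).const_mul
      (normConst_pos β)
    convert this using 1
    ring
  have hv : PowerGrowth (fun n => ((n : ℝ) + (k + 1)) ^ (-(β + 1))) (-(β + 1)) :=
    powerGrowth_natCast_add_rpow (by positivity) _
  rw [lintegral_areaMeasure_sq_norm (fun z hz => hasSum_iteratedDeriv ha k hz) hk,
    tsum_ofReal_lt_top_iff]
  · have h1 := hu.summable_iff (x := fun n => ‖a (n + k)‖ ^ 2) fun n => by positivity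
    have h2 := hv.summable_iff (x := fun n => ‖a (n + k)‖ ^ 2) fun n => by positivity
    -- The `k`-th derivative does not see the first `k` coefficients, which do not affect
    -- summability.
    rw [← summable_nat_add_iff (f := fun n : ℕ => ((n : ℝ) + 1) ^ (-(β + 1)) * ‖a n‖ ^ 2) k]
    refine Iff.trans ?_ ((h1.trans h2.symm).trans ?_)
    · refine summable_congr fun n => ?_
      rw [norm_mul, mul_pow, Complex.norm_real, Real.norm_eq_abs, sq_abs]
      ring
    · refine summable_congr fun n => ?_
      push_cast
      rw [add_assoc]
  · intro n
    have := normConst_pos β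
    have := ProbabilityTheory.beta_pos (α := (n : ℝ) + 1) (by positivity) hs
    positivity

theorem mem_bergmanSpace_of_hasSum {a : ℕ → ℂ} {f : ℂ → ℂ}
    (ha : ∀ z ∈ disk, HasSum (fun n => a n * z ^ n) (f z)) {β : ℝ} {k : ℕ}
    (hk : -1 < 2 * (k : ℝ) + β)
    (hs : Summable fun n : ℕ => ((n : ℝ) + 1) ^ (-(β + 1)) * ‖a n‖ ^ 2) :
    f ∈ bergmanSpace β k :=
  ⟨differentiableOn_of_hasSum ha, (lintegral_iteratedDeriv_lt_top_iff ha hk).2 hs⟩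

theorem exists_hasSum_of_mem_bergmanSpace {f : ℂ → ℂ} {β : ℝ} {k : ℕ}
    (hk : -1 < 2 * (k : ℝ) + β) (hf : f ∈ bergmanSpace β k) :
    ∃ a : ℕ → ℂ, (∀ z ∈ disk, HasSum (fun n => a n * z ^ n) (f z)) ∧
      Summable fun n : ℕ => ((n : ℝ) + 1) ^ (-(β + 1)) * ‖a n‖ ^ 2 :=
  have ha : ∀ z ∈ disk, HasSum (fun n => (n ! : ℂ)⁻¹ * iteratedDeriv n f 0 * z ^ n) (f z) :=
    fun _ hz => hasSum_of_differentiableOn hf.1 hz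
  ⟨_, ha, (lintegral_iteratedDeriv_lt_top_iff ha hk).1 hf.2⟩

theorem memLp_two_iff {X : Type*} [MeasurableSpace X] {μ : Measure X} {f : X → ℂ} :
    MemLp f 2 μ ↔ AEStronglyMeasurable f μ ∧ ∫⁻ t, ENNReal.ofReal (‖f t‖ ^ 2) ∂μ < ⊤ := by
  refine and_congr_right fun _ => ?_
  have h := eLpNorm_nnreal_pow_eq_lintegral (f := f) (μ := μ) (p := 2) two_ne_zero
  simp only [ENNReal.ofReal_pow (norm_nonneg _), ofReal_norm]
  simp only [ENNReal.coe_ofNat, NNReal.coe_ofNat, ENNReal.rpow_ofNat] at h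
  rw [← h, ENNReal.pow_lt_top_iff]
  simp

theorem aestronglyMeasurable_areaMeasure {f : ℂ → ℂ} (hf : ContinuousOn f disk) (β : ℝ) :
    AEStronglyMeasurable f (areaMeasure β) :=
  (hf.aestronglyMeasurable measurableSet_disk).mono_ac (withDensity_absolutelyContinuous _ _)

theorem bergmanSpace_subset_squareIntegrable {β : ℝ} (hβ : -1 < β) {k : ℕ}
    (hk : -1 < 2 * (k : ℝ) + β) : bergmanSpace β k ⊆ squareIntegrable β := by
  intro f hf
  obtain ⟨a, ha, hs⟩ := exists_hasSum_of_mem_bergmanSpace hk hf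
  have h0 : -1 < 2 * ((0 : ℕ) : ℝ) + β := by simpa using hβ
  have h := (lintegral_iteratedDeriv_lt_top_iff ha h0).2 hs
  refine memLp_two_iff.2 ⟨aestronglyMeasurable_areaMeasure hf.1.continuousOn β, ?_⟩
  simpa using h

end Coefficients

/-- With `t² = (n+1)^q`, the AM-GM inequality bounds `|a_n| |z|^n` by `t^(-2) |a_n|² + t² |z|^(2n)`;
the second term is summable because geometric decay beats any power. -/
theorem summable_mul_pow {a : ℕ → ℂ} {q : ℝ}
    (ha : Summable fun n : ℕ => ((n : ℝ) + 1) ^ (-q) * ‖a n‖ ^ 2) {z : ℂ} (hz : z ∈ disk) :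
    Summable fun n => a n * z ^ n := by
  have hz' := mem_disk.1 hz
  obtain ⟨m, hm⟩ := exists_nat_ge q
  have hr : ‖z‖ ^ 2 < 1 := by nlinarith [norm_nonneg z]
  have h1 : Summable fun n : ℕ => ((n : ℝ) + 1) ^ m * (‖z‖ ^ 2) ^ n := by
    have h2 := summable_pow_mul_geometric_of_norm_lt_one m (r := ‖z‖ ^ 2) (by simpa using hr)
    refine (h2.mul_left (2 ^ m)).of_norm_bounded_eventually_nat ?_
    filter_upwards [eventually_ge_atTop 1] with n hn
    have hn' : (1 : ℝ) ≤ n := by exact_mod_cast hn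
    rw [Real.norm_of_nonneg (by positivity), ← mul_assoc, ← mul_pow]
    gcongr
    linarith
  refine Summable.of_norm_bounded (ha.add h1) fun n => ?_
  have hp : (0 : ℝ) < n + 1 := by positivity
  have h3 : ((n : ℝ) + 1) ^ q ≤ ((n : ℝ) + 1) ^ m := by
    rw [← Real.rpow_natCast]
    exact Real.rpow_le_rpow_of_exponent_le (by linarith [(Nat.cast_nonneg n : (0 : ℝ) ≤ n)]) hm
  have h4 : ((n : ℝ) + 1) ^ q * (‖z‖ ^ 2) ^ n ≤ ((n : ℝ) + 1) ^ m * (‖z‖ ^ 2) ^ n := by gcongr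
  refine le_trans ?_ (add_le_add_right h4 _)
  set t := ((n : ℝ) + 1) ^ (q / 2) with ht
  have ht0 : 0 < t := by positivity
  have h5 : ((n : ℝ) + 1) ^ q = t ^ 2 := by
    rw [ht, ← Real.rpow_natCast, ← Real.rpow_mul hp.le]
    congr 1
    push_cast
    ring
  rw [Real.rpow_neg hp.le, h5, norm_mul, norm_pow, ← pow_mul, mul_comm 2 n, pow_mul]
  have h6 : ‖a n‖ * ‖z‖ ^ n = (t⁻¹ * ‖a n‖) * (t * ‖z‖ ^ n) := by field_simp
  rw [h6, ← inv_pow, ← mul_pow, ← mul_pow]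
  have h7 : 0 ≤ (t⁻¹ * ‖a n‖) * (t * ‖z‖ ^ n) := by positivity
  nlinarith [sq_nonneg (t⁻¹ * ‖a n‖ - t * ‖z‖ ^ n)]

/-- The normalizing factor of the monomials: `∫ |w ^ n|² dA_β` is comparable to
`monomialWeight β n ^ (-2)`. -/
noncomputable def monomialWeight (β : ℝ) (n : ℕ) : ℝ := ((n : ℝ) + 1) ^ ((β + 1) / 2)

theorem monomialWeight_pos (β : ℝ) (n : ℕ) : 0 < monomialWeight β n := by
  unfold monomialWeight
  positivity

theorem powerGrowth_monomialWeight_sq (β : ℝ) :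
    PowerGrowth (fun n => monomialWeight β n ^ 2) (β + 1) := by
  have h := (PowerGrowth.rpow ((β + 1) / 2)).sq
  rwa [mul_div_cancel₀ _ two_ne_zero] at h

theorem summable_sq_lp (x : lp (fun _ : ℕ => ℂ) 2) : Summable fun n => ‖x n‖ ^ 2 := by
  simpa using (lp.memℓp x).summable (by simp)

theorem sq_norm_lp (x : lp (fun _ : ℕ => ℂ) 2) : ‖x‖ ^ 2 = ∑' n, ‖x n‖ ^ 2 := by
  simpa using lp.norm_rpow_eq_tsum (p := 2) (by simp) x

/-- The power series whose coefficients with respect to the normalized monomials are `x`. -/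
noncomputable def synthesis (β : ℝ) (x : ℕ → ℂ) (w : ℂ) : ℂ :=
  ∑' n, x n * (monomialWeight β n : ℂ) * w ^ n

section Synthesis

variable {β : ℝ} (x y : lp (fun _ : ℕ => ℂ) 2)

theorem summable_synthesis_coeff :
    Summable fun n : ℕ => ((n : ℝ) + 1) ^ (-(β + 1)) * ‖x n * (monomialWeight β n : ℂ)‖ ^ 2 := by
  convert summable_sq_lp x using 2 with n
  have hp : (0 : ℝ) < n + 1 := by positivity
  rw [norm_mul, mul_pow, Complex.norm_real, Real.norm_eq_abs, sq_abs, monomialWeight,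
    ← Real.rpow_natCast (_ ^ ((β + 1) / 2)), ← Real.rpow_mul hp.le, Real.rpow_neg hp.le]
  have : (β + 1) / 2 * ((2 : ℕ) : ℝ) = β + 1 := by push_cast; ring
  rw [this]
  have := Real.rpow_pos_of_pos hp (β + 1)
  field_simp

theorem hasSum_synthesis {z : ℂ} (hz : z ∈ disk) :
    HasSum (fun n => x n * (monomialWeight β n : ℂ) * z ^ n) (synthesis β x z) :=
  (summable_mul_pow (summable_synthesis_coeff x) hz).hasSum

theorem synthesis_add {z : ℂ} (hz : z ∈ disk) :
    synthesis β (x + y : lp (fun _ : ℕ => ℂ) 2) z = synthesis β x z + synthesis β y z := by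
  refine (hasSum_synthesis (x + y) hz).unique ?_
  convert (hasSum_synthesis x hz).add (hasSum_synthesis y hz) using 2 with n
  simp only [lp.coeFn_add, Pi.add_apply]
  ring

theorem synthesis_smul (c : ℂ) {z : ℂ} (hz : z ∈ disk) :
    synthesis β (c • x : lp (fun _ : ℕ => ℂ) 2) z = c * synthesis β x z := by
  refine (hasSum_synthesis (c • x) hz).unique ?_
  have h := (hasSum_synthesis (β := β) x hz).mul_left c
  simpa only [lp.coeFn_smul, Pi.smul_apply, smul_eq_mul, mul_assoc] using h

theorem synthesis_single (n : ℕ) (z : ℂ) :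
    synthesis β (lp.single 2 n (1 : ℂ) : lp (fun _ : ℕ => ℂ) 2) z = monomialWeight β n * z ^ n := by
  rw [synthesis, tsum_eq_single n]
  · simp
  · intro m hm
    simp [hm]

theorem synthesis_mem_bergmanSpace {k : ℕ} (hk : -1 < 2 * (k : ℝ) + β) :
    synthesis β x ∈ bergmanSpace β k :=
  mem_bergmanSpace_of_hasSum (fun _ hz => hasSum_synthesis x hz) hk (summable_synthesis_coeff x)

/-- Up to constants, `synthesis` is isometric. -/
theorem exists_lintegral_synthesis_bounds (hβ : -1 < β) :
    ∃ c C : ℝ, 0 < c ∧ 0 < C ∧ ∀ x : lp (fun _ : ℕ => ℂ) 2,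
      ENNReal.ofReal (c * ‖x‖ ^ 2) ≤ ∫⁻ z, ENNReal.ofReal (‖synthesis β x z‖ ^ 2) ∂(areaMeasure β) ∧
      ∫⁻ z, ENNReal.ofReal (‖synthesis β x z‖ ^ 2) ∂(areaMeasure β) ≤
        ENNReal.ofReal (C * ‖x‖ ^ 2) := by
  have h0 : -1 < 2 * ((0 : ℕ) : ℝ) + β := by simpa using hβ
  -- The weights are chosen so that the two growth exponents cancel, leaving a sequence bounded
  -- above and away from zero.
  have hu := ((powerGrowth_beta (s := β + 1) (by linarith)).mul
    (powerGrowth_monomialWeight_sq β)).const_mul (normConst_pos β)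
  rw [neg_add_cancel] at hu
  obtain ⟨c, C, hc, hC, h⟩ := hu
  refine ⟨c, C, hc, hC, fun x => ?_⟩
  have h1 := lintegral_areaMeasure_sq_norm (fun z hz => hasSum_synthesis (β := β) x hz) h0
  simp only [mul_zero, pow_zero, one_mul, Nat.cast_zero, zero_add] at h1
  have h2 : ∀ D : ℝ, 0 < D → ENNReal.ofReal (D * ‖x‖ ^ 2) =
      ∑' n, ENNReal.ofReal (D * ‖x n‖ ^ 2) := by
    intro D hD
    rw [sq_norm_lp, ← tsum_mul_left,
      ENNReal.ofReal_tsum_of_nonneg (fun n => by positivity) ((summable_sq_lp x).mul_left D)]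
  have h3 : ∀ n : ℕ, normConst β * ProbabilityTheory.beta (n + 1) (β + 1) *
      ‖x n * (monomialWeight β n : ℂ)‖ ^ 2 = normConst β * (ProbabilityTheory.beta (n + 1) (β + 1) *
        monomialWeight β n ^ 2) * ‖x n‖ ^ 2 := by
    intro n
    rw [norm_mul, mul_pow, Complex.norm_real, Real.norm_eq_abs, sq_abs]
    ring
  simp only [Real.rpow_zero, mul_one] at h
  simp only [h1, h3]
  rw [h2 c hc, h2 C hC]
  constructor
  · exact ENNReal.tsum_le_tsum fun n => ENNReal.ofReal_le_ofReal
      (mul_le_mul_of_nonneg_right (h n).1 (by positivity))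
  · exact ENNReal.tsum_le_tsum fun n => ENNReal.ofReal_le_ofReal
      (mul_le_mul_of_nonneg_right (h n).2 (by positivity))

end Synthesis

theorem ae_mem_disk (β : ℝ) : ∀ᵐ z ∂(areaMeasure β), z ∈ disk :=
  (withDensity_absolutelyContinuous _ _).ae_le (ae_restrict_mem measurableSet_disk)

/-! ### The synthesis operator, its adjoint and the moment problem -/

section Operator

variable {β c₁ c₂ : ℝ} {ν : Measure ℂ}

theorem absolutelyContinuous_of_le (h₂ : ν ≤ ENNReal.ofReal c₂ • areaMeasure β) :
    ν ≪ areaMeasure β :=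
  (Measure.absolutelyContinuous_of_le h₂).trans
    (Measure.smul_absolutelyContinuous)

theorem memLp_of_le (h₂ : ν ≤ ENNReal.ofReal c₂ • areaMeasure β) {g : ℂ → ℂ}
    (hg : g ∈ squareIntegrable β) : MemLp g 2 ν :=
  (MemLp.smul_measure hg ENNReal.ofReal_ne_top).mono_measure h₂

theorem synthesis_memLp (hβ : -1 < β) (h₂ : ν ≤ ENNReal.ofReal c₂ • areaMeasure β)
    (x : lp (fun _ : ℕ => ℂ) 2) : MemLp (synthesis β x) 2 ν :=
  have hk : -1 < 2 * ((0 : ℕ) : ℝ) + β := by simpa using hβ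
  memLp_of_le h₂ (bergmanSpace_subset_squareIntegrable hβ hk (synthesis_mem_bergmanSpace x hk))

theorem exists_synthesis_operator (hβ : -1 < β) (hc₁ : 0 < c₁) (hc₂ : 0 < c₂)
    (h₁ : ENNReal.ofReal c₁ • areaMeasure β ≤ ν) (h₂ : ν ≤ ENNReal.ofReal c₂ • areaMeasure β) :
    ∃ J : lp (fun _ : ℕ => ℂ) 2 →L[ℂ] Lp ℂ 2 ν,
      (∀ x, J x =ᵐ[ν] synthesis β x) ∧ ∃ c : ℝ, 0 < c ∧ ∀ x, c * ‖x‖ ^ 2 ≤ ‖J x‖ ^ 2 := by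
  obtain ⟨c, C, hc, hC, h⟩ := exists_lintegral_synthesis_bounds hβ
  have hae : ∀ᵐ z ∂ν, z ∈ disk := (absolutelyContinuous_of_le h₂).ae_le (ae_mem_disk β)
  have hm := synthesis_memLp hβ h₂
  let J₀ : lp (fun _ : ℕ => ℂ) 2 →ₗ[ℂ] Lp ℂ 2 ν :=
    { toFun := fun x => (hm x).toLp
      map_add' := fun x y => by
        rw [← MemLp.toLp_add, MemLp.toLp_eq_toLp_iff]
        filter_upwards [hae] with z hz using synthesis_add x y hz
      map_smul' := fun a x => by
        rw [RingHom.id_apply, ← MemLp.toLp_const_smul, MemLp.toLp_eq_toLp_iff]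
        filter_upwards [hae] with z hz using synthesis_smul x a hz }
  have hJ : ∀ x, J₀ x =ᵐ[ν] synthesis β x := fun x => (hm x).coeFn_toLp
  have hn : ∀ x, ENNReal.ofReal (‖J₀ x‖ ^ 2) = ∫⁻ z, ENNReal.ofReal (‖synthesis β x z‖ ^ 2) ∂ν := by
    intro x
    rw [ofReal_sq_norm_eq_lintegral]
    refine lintegral_congr_ae ?_
    filter_upwards [hJ x] with z hz
    rw [hz]
  have hup : ∀ x, ‖J₀ x‖ ^ 2 ≤ (c₂ * C) * ‖x‖ ^ 2 := fun x => by
    rw [← ENNReal.ofReal_le_ofReal_iff (by positivity), hn]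
    refine (lintegral_mono' h₂ le_rfl).trans ?_
    rw [lintegral_smul_measure, smul_eq_mul, mul_assoc, ENNReal.ofReal_mul hc₂.le]
    gcongr
    exact (h x).2
  have hlow : ∀ x, (c₁ * c) * ‖x‖ ^ 2 ≤ ‖J₀ x‖ ^ 2 := fun x => by
    rw [← ENNReal.ofReal_le_ofReal_iff (by positivity), hn]
    refine le_trans ?_ (lintegral_mono' h₁ le_rfl)
    rw [lintegral_smul_measure, smul_eq_mul, mul_assoc, ENNReal.ofReal_mul hc₁.le]
    gcongr
    exact (h x).1
  refine ⟨J₀.mkContinuous (√(c₂ * C)) fun x => ?_, hJ, c₁ * c, by positivity, hlow⟩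
  refine (pow_le_pow_iff_left₀ (norm_nonneg _) (by positivity) two_ne_zero).1 ?_
  rw [mul_pow, Real.sq_sqrt (by positivity)]
  exact hup x

/-- Pairing with the `n`-th unit vector, whose image is the weighted monomial, reads off a conjugate
moment. -/
theorem adjoint_synthesis_apply {J : lp (fun _ : ℕ => ℂ) 2 →L[ℂ] Lp ℂ 2 ν}
    (hJ : ∀ x, J x =ᵐ[ν] synthesis β x) {g : ℂ → ℂ} {G : Lp ℂ 2 ν} (hG : G =ᵐ[ν] g) (n : ℕ) :
    (ContinuousLinearMap.adjoint J G : lp (fun _ : ℕ => ℂ) 2) n =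
      monomialWeight β n * ∫ w, starRingEnd ℂ w ^ n * g w ∂ν := by
  have h := lp.inner_single_left (𝕜 := ℂ) n (1 : ℂ) (ContinuousLinearMap.adjoint J G)
  rw [ContinuousLinearMap.adjoint_inner_right, RCLike.inner_apply, map_one, mul_one] at h
  rw [← h, L2.inner_def, ← integral_const_mul]
  refine integral_congr_ae ?_
  filter_upwards [hJ (lp.single 2 n (1 : ℂ)), hG] with w hw hw'
  rw [hw, hw', synthesis_single, RCLike.inner_apply]
  simp only [map_mul, map_pow, Complex.conj_ofReal]
  ring

/-- The conjugate moments of an `L²` function are square summable with the natural weight. -/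
theorem exists_moments_eq (hβ : -1 < β) (hc₁ : 0 < c₁) (hc₂ : 0 < c₂)
    (h₁ : ENNReal.ofReal c₁ • areaMeasure β ≤ ν) (h₂ : ν ≤ ENNReal.ofReal c₂ • areaMeasure β)
    {g : ℂ → ℂ} (hg : MemLp g 2 ν) :
    ∃ y : lp (fun _ : ℕ => ℂ) 2, ∀ n,
      y n = monomialWeight β n * ∫ w, starRingEnd ℂ w ^ n * g w ∂ν := by
  obtain ⟨J, hJ, -⟩ := exists_synthesis_operator hβ hc₁ hc₂ h₁ h₂
  exact ⟨ContinuousLinearMap.adjoint J hg.toLp, adjoint_synthesis_apply hJ hg.coeFn_toLp⟩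

/-- The moment problem is solvable in the Bergman space. -/
theorem exists_synthesis_moments_eq (hβ : -1 < β) (hc₁ : 0 < c₁) (hc₂ : 0 < c₂)
    (h₁ : ENNReal.ofReal c₁ • areaMeasure β ≤ ν) (h₂ : ν ≤ ENNReal.ofReal c₂ • areaMeasure β)
    (y : lp (fun _ : ℕ => ℂ) 2) :
    ∃ x : lp (fun _ : ℕ => ℂ) 2, ∀ n,
      y n = monomialWeight β n * ∫ w, starRingEnd ℂ w ^ n * synthesis β x w ∂ν := by
  obtain ⟨J, hJ, c, hc, hlow⟩ := exists_synthesis_operator hβ hc₁ hc₂ h₁ h₂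
  -- Coercivity: `⟪J*J x, x⟫ = ‖J x‖² ≥ c ‖x‖²`, so `J*J` is invertible and `J*` already maps the
  -- range of `J` onto `ℓ²`.
  have hunit : IsUnit (ContinuousLinearMap.adjoint J ∘L J) := by
    refine ContinuousLinearMap.isUnit_of_forall_le_norm_inner_map _ (Real.toNNReal_pos.2 hc)
      fun x => ?_
    rw [ContinuousLinearMap.comp_apply, ContinuousLinearMap.adjoint_inner_left,
      inner_self_eq_norm_sq_to_K, Real.coe_toNNReal _ hc.le, mul_comm]
    simpa using hlow x
  obtain ⟨x, hx⟩ := (ContinuousLinearMap.isUnit_iff_bijective.1 hunit).2 y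
  exact ⟨x, fun n => by rw [← hx]; exact adjoint_synthesis_apply hJ (hJ x) n⟩

end Operator

/-! ### Comparison of `1 - |φ|²` with `1 - |z|²` -/

section Blaschke

theorem norm_one_sub_conj_mul_ge (a : ℂ) {z : ℂ} (hz : z ∈ disk) :
    1 - ‖a‖ ≤ ‖1 - starRingEnd ℂ a * z‖ := by
  have h1 := mem_disk.1 hz
  have h2 := norm_sub_norm_le (1 : ℂ) (starRingEnd ℂ a * z)
  rw [norm_one, norm_mul, RCLike.norm_conj] at h2
  nlinarith [norm_nonneg a]

theorem one_sub_sq_norm_blaschkeFactor {a z : ℂ} (ha : a ∈ disk) (hz : z ∈ disk) :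
    1 - ‖(z - a) / (1 - starRingEnd ℂ a * z)‖ ^ 2 =
      (1 - ‖a‖ ^ 2) * (1 - ‖z‖ ^ 2) / ‖1 - starRingEnd ℂ a * z‖ ^ 2 := by
  have h0 : 0 < ‖1 - starRingEnd ℂ a * z‖ :=
    lt_of_lt_of_le (by linarith [mem_disk.1 ha]) (norm_one_sub_conj_mul_ge a hz)
  rw [norm_div, div_pow, one_sub_div (by positivity)]
  congr 1
  simp only [Complex.sq_norm, Complex.normSq_apply, Complex.sub_re, Complex.sub_im, Complex.mul_re,
    Complex.mul_im, Complex.conj_re, Complex.conj_im, Complex.one_re, Complex.one_im]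
  ring

theorem one_sub_prod_le_sum {ι : Type*} (s : Finset ι) (t : ι → ℝ) (h0 : ∀ i, 0 ≤ t i)
    (h1 : ∀ i, t i ≤ 1) : 1 - ∏ i ∈ s, t i ≤ ∑ i ∈ s, (1 - t i) := by
  classical
  induction s using Finset.induction_on with
  | empty => simp
  | insert i s hi ih =>
    rw [Finset.prod_insert hi, Finset.sum_insert hi]
    have h2 : ∏ i ∈ s, t i ≤ 1 := Finset.prod_le_one (fun i _ => h0 i) fun i _ => h1 i
    nlinarith [h0 i, h1 i]

/-- For a non-constant finite Blaschke product, `1 - |φ|²` is comparable to `1 - |z|²`. -/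
theorem IsBlaschkeProduct.exists_bounds {n : ℕ} (hn : 1 ≤ n) {φ : ℂ → ℂ}
    (hφ : IsBlaschkeProduct n φ) :
    ∃ m M : ℝ, 0 < m ∧ 0 < M ∧ ∀ z ∈ disk,
      m * (1 - ‖z‖ ^ 2) ≤ 1 - ‖φ z‖ ^ 2 ∧ 1 - ‖φ z‖ ^ 2 ≤ M * (1 - ‖z‖ ^ 2) := by
  obtain ⟨c, a, hc, ha, hφ⟩ := hφ
  have hpos : ∀ i, 0 < 1 - ‖a i‖ ^ 2 := fun i => one_sub_sq_norm_pos (ha i)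
  have hpos' : ∀ i, 0 < 1 - ‖a i‖ := fun i => by linarith [mem_disk.1 (ha i)]
  let i₀ : Fin n := ⟨0, hn⟩
  -- The lower constant comes from a single factor, which exists since `n ≥ 1`, and `|1 - ā z| ≤ 2`.
  -- The upper one bounds `1 - ∏ t i` by `∑ (1 - t i)` and uses `|1 - ā z| ≥ 1 - |a|`.
  refine ⟨(1 - ‖a i₀‖ ^ 2) / 2 ^ 2, ∑ i, (1 - ‖a i‖ ^ 2) / (1 - ‖a i‖) ^ 2, div_pos (hpos _)
    (by positivity), Finset.sum_pos (fun i _ => div_pos (hpos i) (pow_pos (hpos' i) 2))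
      ⟨i₀, Finset.mem_univ _⟩, fun z hz => ?_⟩
  have hz' := one_sub_sq_norm_pos hz
  set t : Fin n → ℝ := fun i => ‖(z - a i) / (1 - starRingEnd ℂ (a i) * z)‖ ^ 2 with ht
  have hD : ∀ i, 0 < ‖1 - starRingEnd ℂ (a i) * z‖ := fun i =>
    lt_of_lt_of_le (hpos' i) (norm_one_sub_conj_mul_ge (a i) hz)
  have h1t : ∀ i, 1 - t i = (1 - ‖a i‖ ^ 2) * (1 - ‖z‖ ^ 2) / ‖1 - starRingEnd ℂ (a i) * z‖ ^ 2 :=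
    fun i => one_sub_sq_norm_blaschkeFactor (ha i) hz
  have ht0 : ∀ i, 0 ≤ t i := fun i => by positivity
  have ht1 : ∀ i, t i ≤ 1 := fun i => by
    have : 0 ≤ 1 - t i := by
      rw [h1t]
      exact div_nonneg (mul_nonneg (hpos i).le hz'.le) (by positivity)
    linarith
  have hprod : ‖φ z‖ ^ 2 = ∏ i, t i := by
    rw [hφ z hz, norm_mul, hc, one_mul, norm_prod, Finset.prod_pow]
  rw [hprod]
  constructor
  · have h2 : ∏ i, t i ≤ t i₀ := by
      rw [← Finset.mul_prod_erase _ _ (Finset.mem_univ i₀)]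
      exact mul_le_of_le_one_right (ht0 _) (Finset.prod_le_one (fun i _ => ht0 i) fun i _ => ht1 i)
    have h3 : ‖1 - starRingEnd ℂ (a i₀) * z‖ ≤ 2 := by
      have h4 := norm_sub_le (1 : ℂ) (starRingEnd ℂ (a i₀) * z)
      rw [norm_one, norm_mul, RCLike.norm_conj] at h4
      have := mem_disk.1 hz
      have := mem_disk.1 (ha i₀)
      nlinarith [norm_nonneg z, norm_nonneg (a i₀)]
    refine le_trans ?_ (sub_le_sub_left h2 1)
    rw [h1t, div_mul_eq_mul_div]
    exact div_le_div_of_nonneg_left (mul_nonneg (hpos _).le hz'.le) (pow_pos (hD _) 2)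
      (pow_le_pow_left₀ (norm_nonneg _) h3 2)
  · refine (one_sub_prod_le_sum _ t ht0 ht1).trans ?_
    rw [Finset.sum_mul]
    refine Finset.sum_le_sum fun i _ => ?_
    rw [h1t, div_mul_eq_mul_div]
    exact div_le_div_of_nonneg_left (mul_nonneg (hpos _).le hz'.le) (pow_pos (hpos' i) 2)
      (pow_le_pow_left₀ (hpos' i).le (norm_one_sub_conj_mul_ge (a i) hz) 2)

theorem IsBlaschkeProduct.continuousOn {n : ℕ} {φ : ℂ → ℂ} (hφ : IsBlaschkeProduct n φ) :
    ContinuousOn φ disk := by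
  obtain ⟨c, a, hc, ha, hφ⟩ := hφ
  refine ContinuousOn.congr ?_ hφ
  refine continuousOn_const.mul (continuousOn_finsetProd _ fun i _ => ?_)
  refine ContinuousOn.div (by fun_prop) (by fun_prop) fun z hz => ?_
  rw [← norm_pos_iff]
  exact lt_of_lt_of_le (by linarith [mem_disk.1 (ha i)]) (norm_one_sub_conj_mul_ge (a i) hz)

end Blaschke

/-! ### Expansion of the kernel -/

section Kernel

theorem hasSum_multichoose_mul_pow (s : ℝ) {x : ℂ} (hx : x ∈ disk) :
    HasSum (fun n => ((Ring.multichoose s n : ℝ) : ℂ) * x ^ n) (1 / (1 - x) ^ (s : ℂ)) := by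
  have h := (Complex.one_div_one_sub_cpow_hasFPowerSeriesOnBall_zero (s : ℂ)).hasSum (y := x) (by
    rw [← ENNReal.ofReal_one, Metric.eball_ofReal]
    exact hx)
  rw [zero_add] at h
  convert! h using 2 with n
  rw [FormalMultilinearSeries.ofScalars_apply_eq, smul_eq_mul, Ring.choose]
  congr 1
  -- The binomial series has the coefficients `choose (s + n - 1) n`, defined as `multichoose` at
  -- `(s + n - 1) - n + 1 = s`.
  rw [show (s : ℂ) + n - 1 - n + 1 = Complex.ofRealHom s by simp; ring, ← Ring.map_multichoose]
  rfl

theorem mul_conj_mem_disk {z w : ℂ} (hz : z ∈ disk) (hw : w ∈ disk) :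
    z * starRingEnd ℂ w ∈ disk := by
  rw [mem_disk, norm_mul, RCLike.norm_conj]
  have h1 := mem_disk.1 hz
  have h2 := mem_disk.1 hw
  nlinarith [norm_nonneg z, norm_nonneg w]

variable {ν : Measure ℂ} {G : ℂ → ℂ} {s : ℝ} {z : ℂ}

/-- For fixed `z` the kernel is bounded in `w`: its series is dominated by the absolutely convergent
series at `|z|`. -/
theorem integrable_kernel_mul (hν : ∀ᵐ w ∂ν, w ∈ disk) (hG : Integrable G ν)
    (hz : z ∈ disk) :
    Integrable (fun w => 1 / (1 - z * starRingEnd ℂ w) ^ (s : ℂ) * G w) ν := by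
  have hx : ((‖z‖ : ℝ) : ℂ) ∈ disk := by
    rw [mem_disk] at hz ⊢
    simpa using hz
  have hsum := (hasSum_multichoose_mul_pow s hx).summable.norm
  refine hG.bdd_mul (c := ∑' n, ‖((Ring.multichoose s n : ℝ) : ℂ) * ((‖z‖ : ℝ) : ℂ) ^ n‖) ?_ ?_
  · refine Measurable.aestronglyMeasurable ?_
    fun_prop
  · filter_upwards [hν] with w hw
    rw [← (hasSum_multichoose_mul_pow s (mul_conj_mem_disk hz hw)).tsum_eq]
    refine tsum_of_norm_bounded hsum.hasSum fun n => ?_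
    rw [norm_mul, norm_mul]
    gcongr
    rw [norm_pow, norm_pow, norm_mul, RCLike.norm_conj, Complex.norm_real, norm_norm]
    exact pow_le_pow_left₀ (by positivity)
      (mul_le_of_le_one_right (norm_nonneg _) (mem_disk.1 hw).le) n

theorem integrable_conj_pow_mul (hν : ∀ᵐ w ∂ν, w ∈ disk) (hG : Integrable G ν) (n : ℕ) :
    Integrable (fun w => starRingEnd ℂ w ^ n * G w) ν := by
  refine hG.bdd_mul (c := 1) ?_ ?_
  · exact (Complex.continuous_conj.pow n).aestronglyMeasurable
  · filter_upwards [hν] with w hw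
    rw [norm_pow, RCLike.norm_conj]
    exact pow_le_one₀ (norm_nonneg _) (mem_disk.1 hw).le

/-- The power series of an integral against the Bergman kernel. -/
theorem hasSum_kernel_integral (hν : ∀ᵐ w ∂ν, w ∈ disk) (hG : Integrable G ν)
    (hz : z ∈ disk) :
    HasSum (fun n => ((Ring.multichoose s n : ℝ) : ℂ) * (∫ w, starRingEnd ℂ w ^ n * G w ∂ν) * z ^ n)
      (∫ w, 1 / (1 - z * starRingEnd ℂ w) ^ (s : ℂ) * G w ∂ν) := by
  have hsum := (hasSum_multichoose_mul_pow s hz).summable.norm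
  -- Integration term by term is justified by the majorant `|γ_n| |z|^n ∫ |G| dν`, with `γ_n =
  -- multichoose s n`.
  have h := hasSum_integral_of_summable_integral_norm (μ := ν)
    (F := fun n w => (((Ring.multichoose s n : ℝ) : ℂ) * z ^ n) * (starRingEnd ℂ w ^ n * G w))
    (fun n => (integrable_conj_pow_mul hν hG n).const_mul _) ?_
  · convert! h using 1
    · funext n
      rw [integral_const_mul]
      ring
    · refine integral_congr_ae ?_
      filter_upwards [hν] with w hw
      rw [← (hasSum_multichoose_mul_pow s (mul_conj_mem_disk hz hw)).tsum_eq, ← tsum_mul_right]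
      refine tsum_congr fun n => ?_
      rw [mul_pow]
      ring
  · refine Summable.of_nonneg_of_le (fun n => integral_nonneg fun w => norm_nonneg _) (fun n => ?_)
      (hsum.mul_right (∫ w, ‖G w‖ ∂ν))
    rw [← integral_const_mul]
    refine integral_mono_ae ((integrable_conj_pow_mul hν hG n).const_mul _).norm
      (hG.norm.const_mul _) ?_
    filter_upwards [hν] with w hw
    rw [norm_mul, norm_mul (_ ^ n) (G w), norm_pow, RCLike.norm_conj]
    gcongr
    exact mul_le_of_le_one_left (norm_nonneg _) (pow_le_one₀ (norm_nonneg _) (mem_disk.1 hw).le)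

end Kernel

/-- The measure `(1 - |φ|²) dA_α`. -/
noncomputable def twistedMeasure (α : ℝ) (φ : ℂ → ℂ) : Measure ℂ :=
  (areaMeasure α).withDensity fun w => ENNReal.ofReal (1 - ‖φ w‖ ^ 2)

/-! ### Comparison of `(1 - |φ|²) dA_α` with `dA_{α+1}` -/

section Twisted

variable {α m M : ℝ} {φ : ℂ → ℂ}

theorem aemeasurable_one_sub_sq_norm (hφ : ContinuousOn φ disk) :
    AEMeasurable (fun w => ENNReal.ofReal (1 - ‖φ w‖ ^ 2)) (volume.restrict disk) := by
  refine ENNReal.measurable_ofReal.comp_aemeasurable ?_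
  exact (continuousOn_const.sub (hφ.norm.pow 2)).aemeasurable measurableSet_disk

theorem twistedMeasure_eq (hφ : ContinuousOn φ disk) :
    twistedMeasure α φ = (volume.restrict disk).withDensity fun w =>
      ENNReal.ofReal (normConst α / Real.pi * (1 - ‖w‖ ^ 2) ^ α) *
        ENNReal.ofReal (1 - ‖φ w‖ ^ 2) := by
  rw [twistedMeasure, areaMeasure, ← withDensity_mul₀ (measurable_density α).aemeasurable
    (aemeasurable_one_sub_sq_norm hφ)]
  rfl

/-- The factor `1 - |z|²` raises the exponent to `α + 1`; the quotient of the constants corrects the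
normalization. -/
theorem density_mul_eq {z : ℂ} (hz : z ∈ disk) (m : ℝ) :
    normConst α / normConst (α + 1) * m * (normConst (α + 1) / Real.pi * (1 - ‖z‖ ^ 2) ^ (α + 1)) =
      normConst α / Real.pi * (1 - ‖z‖ ^ 2) ^ α * (m * (1 - ‖z‖ ^ 2)) := by
  have := normConst_pos (α + 1)
  rw [Real.rpow_add_one (one_sub_sq_norm_pos hz).ne']
  field_simp

theorem smul_areaMeasure_le_twistedMeasure (hm : 0 < m) (hφ : ContinuousOn φ disk)
    (h : ∀ z ∈ disk, m * (1 - ‖z‖ ^ 2) ≤ 1 - ‖φ z‖ ^ 2) :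
    ENNReal.ofReal (normConst α / normConst (α + 1) * m) • areaMeasure (α + 1) ≤
      twistedMeasure α φ := by
  have h1 := normConst_pos α
  have h2 := normConst_pos (α + 1)
  rw [twistedMeasure_eq hφ, areaMeasure, ← withDensity_smul _ (measurable_density _)]
  refine withDensity_mono ?_
  filter_upwards [ae_restrict_mem measurableSet_disk] with z hz
  have hz' := one_sub_sq_norm_pos hz
  rw [Pi.smul_apply, smul_eq_mul, ← ENNReal.ofReal_mul (by positivity), density_mul_eq hz,
    ← ENNReal.ofReal_mul (by positivity)]
  exact ENNReal.ofReal_le_ofReal (mul_le_mul_of_nonneg_left (h z hz) (by positivity))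

theorem twistedMeasure_le_smul_areaMeasure (hM : 0 < M) (hφ : ContinuousOn φ disk)
    (h : ∀ z ∈ disk, 1 - ‖φ z‖ ^ 2 ≤ M * (1 - ‖z‖ ^ 2)) :
    twistedMeasure α φ ≤
      ENNReal.ofReal (normConst α / normConst (α + 1) * M) • areaMeasure (α + 1) := by
  have h1 := normConst_pos α
  have h2 := normConst_pos (α + 1)
  rw [twistedMeasure_eq hφ, areaMeasure, ← withDensity_smul _ (measurable_density _)]
  refine withDensity_mono ?_
  filter_upwards [ae_restrict_mem measurableSet_disk] with z hz
  have hz' := one_sub_sq_norm_pos hz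
  rw [Pi.smul_apply, smul_eq_mul, ← ENNReal.ofReal_mul (by positivity),
    ← ENNReal.ofReal_mul (p := normConst α / normConst (α + 1) * M) (by positivity),
    density_mul_eq hz]
  exact ENNReal.ofReal_le_ofReal (mul_le_mul_of_nonneg_left (h z hz) (by positivity))

theorem toReal_smul_kernel_eq (h : ∀ z ∈ disk, 0 ≤ 1 - ‖φ z‖ ^ 2) (g : ℂ → ℂ) (z : ℂ) {w : ℂ}
    (hw : w ∈ disk) :
    (ENNReal.ofReal (1 - ‖φ w‖ ^ 2)).toReal •
      (1 / (1 - z * starRingEnd ℂ w) ^ ((2 + α : ℝ) : ℂ) * g w) = integrand α φ g z w := by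
  rw [ENNReal.toReal_ofReal (h w hw), integrand, Complex.real_smul]
  ring

theorem aemeasurable_one_sub_sq_norm_areaMeasure (hφ : ContinuousOn φ disk) :
    AEMeasurable (fun w => ENNReal.ofReal (1 - ‖φ w‖ ^ 2)) (areaMeasure α) :=
  (aemeasurable_one_sub_sq_norm hφ).mono_ac (withDensity_absolutelyContinuous _ _)

/-- The factor `1 - |φ|²` moves into the measure. Non-negativity is needed because `ENNReal.ofReal`
truncates at zero. -/
theorem integral_integrand (hφ : ContinuousOn φ disk) (h : ∀ z ∈ disk, 0 ≤ 1 - ‖φ z‖ ^ 2)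
    (g : ℂ → ℂ) (z : ℂ) :
    ∫ w, integrand α φ g z w ∂(areaMeasure α) =
      ∫ w, 1 / (1 - z * starRingEnd ℂ w) ^ ((2 + α : ℝ) : ℂ) * g w ∂(twistedMeasure α φ) := by
  rw [twistedMeasure, integral_withDensity_eq_integral_toReal_smul₀
    (aemeasurable_one_sub_sq_norm_areaMeasure hφ)
    (Eventually.of_forall fun w => ENNReal.ofReal_lt_top)]
  refine integral_congr_ae ?_
  filter_upwards [ae_mem_disk α] with w hw
  exact (toReal_smul_kernel_eq h g z hw).symm

theorem integrable_integrand (hφ : ContinuousOn φ disk) (h : ∀ z ∈ disk, 0 ≤ 1 - ‖φ z‖ ^ 2)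
    {g : ℂ → ℂ} {z : ℂ}
    (hg : Integrable (fun w => 1 / (1 - z * starRingEnd ℂ w) ^ ((2 + α : ℝ) : ℂ) * g w)
      (twistedMeasure α φ)) :
    Integrable (integrand α φ g z) (areaMeasure α) := by
  rw [twistedMeasure, integrable_withDensity_iff_integrable_smul₀'
    (aemeasurable_one_sub_sq_norm_areaMeasure hφ)
    (Eventually.of_forall fun w => ENNReal.ofReal_lt_top)] at hg
  refine hg.congr ?_
  filter_upwards [ae_mem_disk α] with w hw
  exact toReal_smul_kernel_eq h g z hw

end Twisted

/-! ### Passage between moments and Taylor coefficients -/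

theorem isFiniteMeasure_areaMeasure {β : ℝ} (hβ : -1 < β) : IsFiniteMeasure (areaMeasure β) := by
  obtain ⟨c, C, hc, hC, h⟩ := exists_lintegral_synthesis_bounds hβ
  -- The unit vector with index `0` is sent to the constant function `1`, so the upper bound
  -- controls the total mass.
  have h1 := (h (lp.single 2 0 (1 : ℂ))).2
  simp only [synthesis_single, monomialWeight] at h1
  refine ⟨lt_of_le_of_lt (le_of_eq_of_le ?_ h1) ENNReal.ofReal_lt_top⟩
  simp

theorem memℓp_two_of_summable {y : ℕ → ℂ} (hy : Summable fun n => ‖y n‖ ^ 2) : Memℓp y 2 :=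
  memℓp_gen (by simpa using hy)

/-- The exponents add up to `2 (α + 1) - (α + 2) = α`. This is the factor between the squares of a
weighted moment and of the Taylor coefficient it produces. -/
theorem powerGrowth_coeff_ratio {α : ℝ} (hα : -1 < α) :
    PowerGrowth (fun n => Ring.multichoose (2 + α) n ^ 2 * (monomialWeight (α + 1) n ^ 2)⁻¹) α := by
  have h := (powerGrowth_multichoose (s := 2 + α) (by linarith)).sq.mul
    (powerGrowth_monomialWeight_sq (α + 1)).inv
  convert h using 1
  ring

section Ranges

variable {α c₁ c₂ : ℝ} {ν : Measure ℂ}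

/-- The Bergman kernel of index `α` maps `L²(ν)` into `A²_{α - 1}`. -/
theorem mem_bergmanSpace_of_kernel_integral (hα : -1 < α) (hc₁ : 0 < c₁) (hc₂ : 0 < c₂)
    (h₁ : ENNReal.ofReal c₁ • areaMeasure (α + 1) ≤ ν)
    (h₂ : ν ≤ ENNReal.ofReal c₂ • areaMeasure (α + 1)) {g f : ℂ → ℂ} (hg : MemLp g 2 ν)
    (hgi : Integrable g ν)
    (hf : ∀ z ∈ disk, f z = ∫ w, 1 / (1 - z * starRingEnd ℂ w) ^ ((2 + α : ℝ) : ℂ) * g w ∂ν)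
    {k : ℕ} (hk : -1 < 2 * (k : ℝ) + (α - 1)) : f ∈ bergmanSpace (α - 1) k := by
  have hν : ∀ᵐ w ∂ν, w ∈ disk := (absolutelyContinuous_of_le h₂).ae_le (ae_mem_disk _)
  obtain ⟨y, hy⟩ := exists_moments_eq (by linarith) hc₁ hc₂ h₁ h₂ hg
  refine mem_bergmanSpace_of_hasSum (fun z hz => hf z hz ▸ hasSum_kernel_integral hν hgi hz) hk ?_
  -- The exponents cancel, so the coefficient sum defining `A²_{α-1}` is comparable to `∑ |y_n|²`.
  have hu := (PowerGrowth.rpow (-α)).mul (powerGrowth_coeff_ratio hα)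
  have h3 := (hu.summable_iff (x := fun n => ‖y n‖ ^ 2) fun n => by positivity).2
    (by simpa using summable_sq_lp y)
  rw [sub_add_cancel]
  convert h3 using 2 with n
  have hw := monomialWeight_pos (α + 1) n
  rw [hy n, norm_mul, norm_mul, mul_pow, mul_pow, Complex.norm_real, Complex.norm_real,
    Real.norm_eq_abs, Real.norm_eq_abs, sq_abs, sq_abs]
  field_simp

/-- The Bergman kernel of index `α` maps `A²_{α + 1}`, as a subspace of `L²(ν)`, onto
`A²_{α - 1}`. -/
theorem exists_kernel_integral_eq (hα : -1 < α) (hc₁ : 0 < c₁) (hc₂ : 0 < c₂)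
    (h₁ : ENNReal.ofReal c₁ • areaMeasure (α + 1) ≤ ν)
    (h₂ : ν ≤ ENNReal.ofReal c₂ • areaMeasure (α + 1))
    (hi : ∀ g : ℂ → ℂ, MemLp g 2 ν → Integrable g ν)
    {k j : ℕ} (hk : -1 < 2 * (k : ℝ) + (α - 1)) (hj : -1 < 2 * (j : ℝ) + (α + 1)) {f : ℂ → ℂ}
    (hf : f ∈ bergmanSpace (α - 1) k) :
    ∃ g ∈ bergmanSpace (α + 1) j, ∀ z ∈ disk,
      f z = ∫ w, 1 / (1 - z * starRingEnd ℂ w) ^ ((2 + α : ℝ) : ℂ) * g w ∂ν := by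
  have hν : ∀ᵐ w ∂ν, w ∈ disk := (absolutelyContinuous_of_le h₂).ae_le (ae_mem_disk _)
  have hβ : -1 < α + 1 := by linarith
  obtain ⟨a, ha, hs⟩ := exists_hasSum_of_mem_bergmanSpace hk hf
  have hγ : ∀ n, 0 < Ring.multichoose (2 + α) n := multichoose_pos (by linarith)
  have hw := monomialWeight_pos (α + 1)
  -- The moments have to be `a_n / γ_n`, with `γ_n = multichoose (2 + α) n`; multiplied by the
  -- monomial weights they form a sequence in `ℓ²`.
  let y : ℕ → ℂ := fun n => ((monomialWeight (α + 1) n / Ring.multichoose (2 + α) n : ℝ) : ℂ) * a n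
  have hy : Summable fun n => ‖y n‖ ^ 2 := by
    rw [sub_add_cancel] at hs
    have h3 := ((powerGrowth_coeff_ratio hα).inv.summable_iff (x := fun n => ‖a n‖ ^ 2)
      fun n => by positivity).2 hs
    convert h3 using 2 with n
    rw [norm_mul, mul_pow, Complex.norm_real, Real.norm_eq_abs, sq_abs, div_pow, mul_inv, inv_inv]
    ring
  obtain ⟨x, hx⟩ := exists_synthesis_moments_eq hβ hc₁ hc₂ h₁ h₂
    (⟨y, memℓp_two_of_summable hy⟩ : lp (fun _ : ℕ => ℂ) 2)
  refine ⟨synthesis (α + 1) x, synthesis_mem_bergmanSpace x hj, fun z hz => ?_⟩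
  have hK := hasSum_kernel_integral (s := 2 + α) hν
    (hi _ (synthesis_memLp hβ h₂ x)) hz
  refine (ha z hz).unique ?_
  convert! hK using 2 with n
  congr 1
  have h4 : ((monomialWeight (α + 1) n / Ring.multichoose (2 + α) n : ℝ) : ℂ) * a n =
      monomialWeight (α + 1) n * ∫ w, starRingEnd ℂ w ^ n * synthesis (α + 1) x w ∂ν := hx n
  have h5 : (monomialWeight (α + 1) n : ℂ) ≠ 0 := by exact_mod_cast (hw n).ne'
  have h6 : ((Ring.multichoose (2 + α) n : ℝ) : ℂ) ≠ 0 := by exact_mod_cast (hγ n).ne'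
  refine mul_left_cancel₀ h5 ?_
  rw [mul_left_comm, ← h4]
  push_cast
  field_simp

end Ranges

end WeightedBergman

theorem proposition15 (α : ℝ) (hα : -1 < α)
    (n : ℕ) (hn : 1 ≤ n) (φ : ℂ → ℂ) (hφ : WeightedBergman.IsBlaschkeProduct n φ)
    (k : ℕ) (hk : -1 < 2 * (k : ℝ) + (α - 1)) (j : ℕ) (hj : -1 < 2 * (j : ℝ) + (α + 1)) :
    (∀ g ∈ WeightedBergman.bergmanSpace (α + 1) j ∪ WeightedBergman.squareIntegrable (α + 1),
      ∀ z ∈ WeightedBergman.disk,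
        MeasureTheory.Integrable (WeightedBergman.integrand α φ g z)
          (WeightedBergman.areaMeasure α)) ∧
    WeightedBergman.bergmanSpace (α - 1) k =
      WeightedBergman.integralImage α φ (WeightedBergman.bergmanSpace (α + 1) j) ∧
    WeightedBergman.bergmanSpace (α - 1) k =
      WeightedBergman.integralImage α φ (WeightedBergman.squareIntegrable (α + 1)) := by
  open WeightedBergman MeasureTheory in
  have hβ : -1 < α + 1 := by linarith
  have hc := hφ.continuousOn
  obtain ⟨m, M, hm, hM, hb⟩ := hφ.exists_bounds hn
  have h0 : ∀ z ∈ disk, 0 ≤ 1 - ‖φ z‖ ^ 2 := fun z hz =>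
    (mul_pos hm (one_sub_sq_norm_pos hz)).le.trans (hb z hz).1
  have hr : 0 < normConst α / normConst (α + 1) := div_pos (normConst_pos _) (normConst_pos _)
  have h₁ := smul_areaMeasure_le_twistedMeasure (α := α) hm hc fun z hz => (hb z hz).1
  have h₂ := twistedMeasure_le_smul_areaMeasure (α := α) hM hc fun z hz => (hb z hz).2
  have hν : ∀ᵐ w ∂(twistedMeasure α φ), w ∈ disk :=
    (absolutelyContinuous_of_le h₂).ae_le (ae_mem_disk _)
  -- The measure is finite, so `L²` lies in `L¹`; this yields the absolute convergence.
  have hi : ∀ g : ℂ → ℂ, MemLp g 2 (twistedMeasure α φ) → Integrable g (twistedMeasure α φ) := by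
    have := isFiniteMeasure_areaMeasure hβ
    have := (areaMeasure (α + 1)).smul_finite
      (ENNReal.ofReal_ne_top (r := normConst α / normConst (α + 1) * M))
    have : IsFiniteMeasure (twistedMeasure α φ) :=
      isFiniteMeasure_of_le _ h₂
    exact fun g hg => hg.integrable one_le_two
  have hsub := bergmanSpace_subset_squareIntegrable hβ hj
  -- Both equalities follow from the closed chain: `A²_{α-1}` lies in the image of `A²_{α+1}`, which
  -- lies in the image of `L²`, which lies in `A²_{α-1}`.
  have honto : bergmanSpace (α - 1) k ⊆ integralImage α φ (bergmanSpace (α + 1) j) := by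
    intro f hf
    obtain ⟨g, hg, hfg⟩ := exists_kernel_integral_eq hα (mul_pos hr hm) (mul_pos hr hM) h₁ h₂ hi
      hk hj hf
    exact ⟨g, hg, fun z hz => by rw [integral_integrand hc h0, hfg z hz]⟩
  have hmono : integralImage α φ (bergmanSpace (α + 1) j) ⊆
      integralImage α φ (squareIntegrable (α + 1)) := fun f ⟨g, hg, hfg⟩ => ⟨g, hsub hg, hfg⟩
  have hinto : integralImage α φ (squareIntegrable (α + 1)) ⊆ bergmanSpace (α - 1) k := by
    rintro f ⟨g, hg, hfg⟩
    have hg' := memLp_of_le h₂ hg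
    exact mem_bergmanSpace_of_kernel_integral hα (mul_pos hr hm) (mul_pos hr hM) h₁ h₂ hg'
      (hi g hg') (fun z hz => by rw [hfg z hz, integral_integrand hc h0]) hk
  refine ⟨fun g hg z hz => ?_, honto.antisymm (hmono.trans hinto),
    (honto.trans hmono).antisymm hinto⟩
  have hg' : g ∈ squareIntegrable (α + 1) := hg.elim (fun h => hsub h) id
  exact integrable_integrand hc h0 (integrable_kernel_mul hν (hi g (memLp_of_le h₂ hg')) hz)
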